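/- Let $A$ be analytic in the unit disc $\mathbb{D}=\{z\in\mathbb{C}:|z|<1\}$ and let $M_\infty(r,A)=\max_{|z|=r}|A(z)|$ for $0\le r<1$. Suppose that there exists $0\le r_0<1$ such that $$\int_{r_0}^1 M_\infty(r,A)^2\exp\!\left(2\int_{r_0}^r M_\infty(t,A)(1-t)\,dt\right)(1-r^2)^3\,dr<\infty.$$ Then every analytic solution $f$ in $\mathbb{D}$ of the differential equation $f''+Af=0$ belongs to $\mathrm{VMOA}$. Here an analytic function $f$ in $\mathbb{D}$ belongs to $\mathrm{VMOA}$ if $\|g_a\|_{H^2}^2\to 0$ as $|a|\to 1^-$, where $g_a(z)=f(\varphi_a(z))-f(a)$ and $\varphi_a(z)=(a-z)/(1-\overline{a}z)$ for $a,z\in\mathbb{D}$, and $\|g\|_{H^2}^2=\lim_{r\to1^-}\frac1{2\pi}\int_0^{2\pi}|g(re^{i\theta})|^2\,d\theta\in[0,\infty]$. -/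

import Mathlib

open Filter Topology MeasureTheory
open scoped ENNReal

noncomputable section

namespace DiscODE

/-- The open unit disc of the complex plane. -/
def disc : Set ℂ := Metric.ball 0 1

/-- The maximum modulus `M_∞(r, A) = max_{|z| = r} |A z|`. For `0 ≤ r < 1` and `A` analytic in the
unit disc the circle is compact and nonempty, so that the supremum is attained. -/
def maxModulus (r : ℝ) (A : ℂ → ℂ) : ℝ :=
  sSup ((fun z : ℂ => ‖A z‖) '' Metric.sphere 0 r)

/-- `f` is an analytic solution of `f'' + A f = 0` in the unit disc. -/
def IsSolution (A f : ℂ → ℂ) : Prop :=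
  DifferentiableOn ℂ f disc ∧ ∀ z ∈ disc, deriv (deriv f) z + A z * f z = 0

/-- The squared integral mean `(1 / 2π) ∫_0^{2π} |g (r e^{iθ})|² dθ`, as an extended nonnegative
real. -/
def integralMeanSq (g : ℂ → ℂ) (r : ℝ) : ℝ≥0∞ :=
  (ENNReal.ofReal (2 * Real.pi))⁻¹ *
    ∫⁻ θ in Set.Ioc 0 (2 * Real.pi), ‖g (r * Complex.exp (θ * Complex.I))‖ₑ ^ 2

/-- The squared Hardy norm `‖g‖²_{H²}`, the limit of the squared integral means as `r → 1⁻`, with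
value `∞` if `g` is not in `H²`. For `g` analytic in the disc the means are nondecreasing in `r`, so
that the limit exists in `[0, ∞]` and coincides with the `limsup`. -/
def hardyNormSq (g : ℂ → ℂ) : ℝ≥0∞ :=
  limsup (integralMeanSq g) (𝓝[<] (1 : ℝ))

/-- The disc automorphism `φ_a(z) = (a - z) / (1 - conj a * z)`. -/
def phi (a z : ℂ) : ℂ := (a - z) / (1 - (starRingEnd ℂ) a * z)

/-- The function `g_a(z) = f (φ_a z) - f a`. -/
def gFun (f : ℂ → ℂ) (a z : ℂ) : ℂ := f (phi a z) - f a

/-- `f ∈ VMOA`: `f` is analytic in the unit disc and `‖g_a‖²_{H²} → 0` as `|a| → 1⁻`. -/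
def IsVMOA (f : ℂ → ℂ) : Prop :=
  DifferentiableOn ℂ f disc ∧
    Tendsto (fun a : ℂ => hardyNormSq (gFun f a))
      (comap (fun a : ℂ => ‖a‖) (𝓝[<] (1 : ℝ))) (𝓝 0)

end DiscODE

end

open scoped Pointwise ComplexConjugate

namespace DiscODE

/-! Write `M` for the maximum modulus of `A` and `a` for the `r₀` of the hypothesis. Expanding a
solution to first order along a radius, with integral remainder, and applying Grönwall gives
`|f(ru)| ≤ C exp(∫_a^r M(t)(1-t) dt)` (`exists_norm_solution_le`). Since `f'' = -Af`, the second
derivative has the radial majorant `h(r) = C M(r) exp(∫_a^r M(t)(1-t) dt)`, and the hypothesis says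
that `h(r)²(1-r²)³` is integrable near 1. A weighted Hardy inequality
(`integrableOn_sq_primitive_mul`) passes from `h` to its primitive `N`, which majorizes `f'` and
satisfies `∫ N(r)²(1-r) dr < ∞`.

This radial condition implies VMOA (`isVMOA_of_norm_deriv_le`). Littlewood-Paley and a conformal
change of variables bound `‖g_a‖²` by a multiple of `∫ |f'|²(1-|φ_a|²)`. Integrating over circles
first, with `N` in place of `|f'|`, leaves `∫ N(r)²(1-r²)·(1-|a|²)/(1-|a|²r²) dr`, where `a` is now
the point of the disc. The quotient is at most 1 and tends to 0 for each `r < 1`, so dominated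
convergence concludes. -/

lemma mem_disc {z : ℂ} : z ∈ disc ↔ ‖z‖ < 1 := by
  simp [disc]

lemma isOpen_disc : IsOpen disc := Metric.isOpen_ball

/-! ### Parseval on circles and Taylor coefficients -/

lemma integralMeanSq_eq_ofReal_circleAverage {g : ℂ → ℂ} (hg : Continuous g) (r : ℝ) :
    integralMeanSq g r =
      ENNReal.ofReal (Real.circleAverage (fun z => ‖g (r * z)‖ ^ 2) 0 1) := by
  have hcont : Continuous fun θ : ℝ => ‖g (r * Complex.exp (θ * Complex.I))‖ ^ 2 := by fun_prop
  rw [Real.circleAverage_def, smul_eq_mul, ENNReal.ofReal_mul (by positivity),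
    ENNReal.ofReal_inv_of_pos (by positivity), intervalIntegral.integral_of_le (by positivity),
    integralMeanSq]
  simp only [circleMap, zero_add, Complex.ofReal_one, one_mul]
  rw [ofReal_integral_eq_lintegral_ofReal
    ((hcont.integrableOn_Icc (μ := volume)).mono_set Set.Ioc_subset_Icc_self)
    (Eventually.of_forall fun _ => by positivity)]
  simp [ENNReal.ofReal_pow]

/-- Absorbing the radius into the coefficients `c n * r ^ n` reduces this to Parseval for
polynomials on the unit circle. -/
lemma integralMeanSq_sum_range (c : ℕ → ℂ) {r : ℝ} (hr : 0 ≤ r) (N : ℕ) :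
    integralMeanSq (fun z => ∑ n ∈ Finset.range N, c n * z ^ n) r =
      ∑ n ∈ Finset.range N, ‖c n‖ₑ ^ 2 * ENNReal.ofReal r ^ (2 * n) := by
  set p : Polynomial ℂ := ∑ n ∈ Finset.range N, Polynomial.monomial n (c n * r ^ n) with hp
  have hcoeff : ∀ n, p.coeff n = if n < N then c n * r ^ n else 0 := by
    intro n
    simp [hp, Polynomial.finsetSum_coeff, Polynomial.coeff_monomial]
  have heval : ∀ z, p.eval z = ∑ n ∈ Finset.range N, c n * (r * z) ^ n := by
    intro z
    simp only [hp, Polynomial.eval_finsetSum, Polynomial.eval_monomial, mul_pow]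
    exact Finset.sum_congr rfl fun _ _ => by ring
  rw [integralMeanSq_eq_ofReal_circleAverage (by fun_prop)]
  simp_rw [← heval]
  rw [← Polynomial.sum_sq_norm_coeff_eq_circleAverage]
  rw [Finset.sum_subset (s₂ := Finset.range N)]
  · rw [ENNReal.ofReal_sum_of_nonneg (fun _ _ => by positivity)]
    refine Finset.sum_congr rfl fun n hn => ?_
    rw [hcoeff, if_pos (Finset.mem_range.1 hn), norm_mul, mul_pow,
      ENNReal.ofReal_mul (by positivity), ENNReal.ofReal_pow (norm_nonneg _), ofReal_norm,
      norm_pow, Complex.norm_real, Real.norm_of_nonneg hr, ← pow_mul,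
      ENNReal.ofReal_pow hr, mul_comm n]
  · intro n hn
    rw [Polynomial.mem_support_iff, hcoeff] at hn
    by_contra h
    simp_all
  · intro n _ hn
    simp [Polynomial.notMem_support_iff.1 hn]

/-- Parseval's identity for a power series on a circle. -/
lemma integralMeanSq_eq_tsum {g : ℂ → ℂ} {c : ℕ → ℂ} {r : ℝ} (hr : 0 ≤ r)
    (hc : Summable fun n => ‖c n‖ * r ^ n)
    (hg : ∀ z : ℂ, ‖z‖ = r → HasSum (fun n => c n * z ^ n) (g z)) :
    integralMeanSq g r = ∑' n, ‖c n‖ₑ ^ 2 * ENNReal.ofReal r ^ (2 * n) := by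
  have hlim : Tendsto
      (fun N => integralMeanSq (fun z => ∑ n ∈ Finset.range N, c n * z ^ n) r) atTop
      (𝓝 (integralMeanSq g r)) := by
    refine ENNReal.Tendsto.const_mul ?_ (Or.inr (by simp [Real.pi_pos]))
    refine tendsto_lintegral_of_dominated_convergence
      (fun _ => ENNReal.ofReal (∑' n, ‖c n‖ * r ^ n) ^ 2) (fun N => ?_) (fun N => ?_) ?_ ?_
    · exact Continuous.measurable (by fun_prop)
    · refine Eventually.of_forall fun θ => ?_
      refine pow_le_pow_left' ?_ 2
      rw [← ofReal_norm]
      refine ENNReal.ofReal_le_ofReal ((norm_sum_le _ _).trans ?_)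
      have : ∀ n, ‖c n * (r * Complex.exp (θ * Complex.I)) ^ n‖ = ‖c n‖ * r ^ n := by
        intro n
        simp [Complex.norm_exp_ofReal_mul_I, abs_of_nonneg hr]
      simp_rw [this]
      exact hc.sum_le_tsum _ fun _ _ => by positivity
    · simp [ENNReal.mul_eq_top]
    · refine Eventually.of_forall fun θ => ?_
      have := (hg (r * Complex.exp (θ * Complex.I))
        (by simp [Complex.norm_exp_ofReal_mul_I, abs_of_nonneg hr])).tendsto_sum_nat
      exact (ENNReal.continuous_pow 2).continuousAt.tendsto.comp this.enorm
  refine tendsto_nhds_unique hlim ?_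
  simp_rw [integralMeanSq_sum_range c hr]
  exact ENNReal.summable.hasSum.tendsto_sum_nat

/-- The Taylor coefficients of `g` at the origin. -/
noncomputable def taylorCoeff (g : ℂ → ℂ) (n : ℕ) : ℂ := (n.factorial : ℂ)⁻¹ * iteratedDeriv n g 0

lemma hasSum_taylorCoeff {g : ℂ → ℂ} (hg : DifferentiableOn ℂ g disc) {z : ℂ} (hz : z ∈ disc) :
    HasSum (fun n => taylorCoeff g n * z ^ n) (g z) := by
  refine (Complex.hasSum_taylorSeries_on_ball hg hz).congr_fun ?_
  intro n
  simp [taylorCoeff]; ring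

lemma taylorCoeff_deriv (g : ℂ → ℂ) (n : ℕ) :
    taylorCoeff (deriv g) n = (n + 1) * taylorCoeff g (n + 1) := by
  have h1 : (n.factorial : ℂ) ≠ 0 := by exact_mod_cast n.factorial_ne_zero
  have h2 : (n + 1 : ℂ) ≠ 0 := by exact_mod_cast n.succ_ne_zero
  rw [taylorCoeff, taylorCoeff, iteratedDeriv_succ', Nat.factorial_succ]
  push_cast
  field_simp

lemma integralMeanSq_eq_tsum_taylorCoeff {g : ℂ → ℂ} (hg : DifferentiableOn ℂ g disc) {r : ℝ}
    (hr : 0 ≤ r) (hr1 : r < 1) :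
    integralMeanSq g r = ∑' n, ‖taylorCoeff g n‖ₑ ^ 2 * ENNReal.ofReal r ^ (2 * n) := by
  refine integralMeanSq_eq_tsum hr ?_ fun z hz => hasSum_taylorCoeff hg (mem_disc.2 (hz ▸ hr1))
  have := (hasSum_taylorCoeff hg (z := (r : ℂ))
    (mem_disc.2 (by simpa [abs_of_nonneg hr]))).summable.norm
  simpa [abs_of_nonneg hr] using this

/-! ### Polar coordinates and the Littlewood-Paley estimate -/

/-- Polar coordinates use the angles `(-π, π)` and the integral means use `(0, 2π]`; both integrals
equal the one over the circle `AddCircle (2π)`. -/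
lemma lintegral_angle_eq (F : ℂ → ℝ≥0∞) (r : ℝ) :
    ∫⁻ θ in Set.Ioo (-Real.pi) Real.pi, F (r * Complex.exp (θ * Complex.I)) =
      ∫⁻ θ in Set.Ioc 0 (2 * Real.pi), F (r * Complex.exp (θ * Complex.I)) := by
  have : Fact (0 < 2 * Real.pi) := ⟨by positivity⟩
  have key : ∀ t : ℝ, ∫⁻ θ in Set.Ioc t (t + 2 * Real.pi), F (r * Complex.exp (θ * Complex.I)) =
      ∫⁻ b : AddCircle (2 * Real.pi), F (r * (AddCircle.toCircle b : ℂ)) := by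
    intro t
    rw [← AddCircle.lintegral_preimage (2 * Real.pi) t]
    simp [AddCircle.toCircle_apply_mk]
  rw [setLIntegral_congr Ioo_ae_eq_Ioc]
  have h1 := key (-Real.pi)
  have h2 := key 0
  rw [zero_add] at h2
  rw [h2, ← h1]
  congr 3
  ring

/-- Integration over the disc in polar coordinates. -/
lemma lintegral_disc_eq {g : ℂ → ℂ} (hg : ContinuousOn g disc) {W : ℝ → ℝ≥0∞} (hW : Measurable W) :
    ∫⁻ z in disc, ‖g z‖ₑ ^ 2 * W ‖z‖ =
      ENNReal.ofReal (2 * Real.pi) *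
        ∫⁻ r in Set.Ioo (0 : ℝ) 1, ENNReal.ofReal r * W r * integralMeanSq g r := by
  classical
  have hmeas : Measurable (disc.indicator fun z => ‖g z‖ₑ ^ 2 * W ‖z‖) := by
    have h1 : Measurable (disc.indicator g) :=
      hg.measurable_piecewise continuousOn_const isOpen_disc.measurableSet
    have h2 : (disc.indicator fun z => ‖g z‖ₑ ^ 2 * W ‖z‖) =
        fun z => ‖disc.indicator g z‖ₑ ^ 2 * W ‖z‖ := by
      ext z
      by_cases hz : z ∈ disc <;> simp [hz]
    rw [h2]
    fun_prop
  rw [← lintegral_indicator isOpen_disc.measurableSet, ← Complex.lintegral_comp_polarCoord_symm,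
    polarCoord_target, Measure.volume_eq_prod, setLIntegral_prod]
  swap
  · refine Measurable.aemeasurable ?_
    simp only [Complex.polarCoord_symm_apply, smul_eq_mul]
    refine Measurable.mul (by fun_prop) (hmeas.comp (Continuous.measurable (by fun_prop)))
  have hpt : ∀ r ∈ Set.Ioi (0 : ℝ), ∫⁻ θ in Set.Ioo (-Real.pi) Real.pi,
      ENNReal.ofReal (r, θ).1 • (disc.indicator fun z => ‖g z‖ₑ ^ 2 * W ‖z‖)
        (Complex.polarCoord.symm (r, θ)) =
      (Set.Iio (1 : ℝ)).indicator
        (fun r => ENNReal.ofReal (2 * Real.pi) * (ENNReal.ofReal r * W r * integralMeanSq g r)) r := by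
    intro r hr
    have hr0 : (0 : ℝ) < r := hr
    have hn : ∀ θ : ℝ, ‖(r * Complex.exp (θ * Complex.I) : ℂ)‖ = r := by
      intro θ
      simp [Complex.norm_exp_ofReal_mul_I, abs_of_pos hr0]
    simp only [Complex.polarCoord_symm_apply, smul_eq_mul, Complex.ofReal_cos, Complex.ofReal_sin,
      ← Complex.exp_mul_I]
    by_cases h1 : r < 1
    · rw [Set.indicator_of_mem (show r ∈ Set.Iio (1 : ℝ) from h1)]
      have : ∀ θ : ℝ, (disc.indicator fun z => ‖g z‖ₑ ^ 2 * W ‖z‖)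
          (r * Complex.exp (θ * Complex.I)) =
          W r * ‖g (r * Complex.exp (θ * Complex.I))‖ₑ ^ 2 := by
        intro θ
        rw [Set.indicator_of_mem (mem_disc.2 (by rwa [hn])), hn, mul_comm]
      simp_rw [this]
      have hgr : Measurable fun θ : ℝ => ‖g (r * Complex.exp (θ * Complex.I))‖ₑ ^ 2 := by
        have : Continuous fun θ : ℝ => g (r * Complex.exp (θ * Complex.I)) :=
          hg.comp_continuous (by fun_prop) fun θ => mem_disc.2 (by rwa [hn])
        exact (Continuous.measurable this).enorm.pow_const 2
      rw [lintegral_const_mul _ (by fun_prop), lintegral_const_mul _ (by fun_prop),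
        lintegral_angle_eq (fun z => ‖g z‖ₑ ^ 2), integralMeanSq]
      have hpi : ENNReal.ofReal (2 * Real.pi) * (ENNReal.ofReal (2 * Real.pi))⁻¹ = 1 :=
        ENNReal.mul_inv_cancel (by simp [Real.pi_pos]) ENNReal.ofReal_ne_top
      generalize ∫⁻ θ in Set.Ioc 0 (2 * Real.pi), _ = J
      calc _ = 1 * (ENNReal.ofReal r * (W r * J)) := by rw [one_mul]
        _ = _ := by rw [← hpi]; ring
    · rw [Set.indicator_of_notMem (show r ∉ Set.Iio (1 : ℝ) from h1)]
      have : ∀ θ : ℝ, (disc.indicator fun z => ‖g z‖ₑ ^ 2 * W ‖z‖)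
          (r * Complex.exp (θ * Complex.I)) = 0 := fun θ =>
        Set.indicator_of_notMem (fun h => h1 (by have := mem_disc.1 h; rwa [hn] at this)) _
      simp [this]
  rw [setLIntegral_congr_fun measurableSet_Ioi hpt, setLIntegral_indicator measurableSet_Iio,
    Set.inter_comm, Set.Ioi_inter_Iio, lintegral_const_mul' _ _ ENNReal.ofReal_ne_top]

lemma lintegral_pow_mul_one_sub_sq (n : ℕ) :
    ∫⁻ r in Set.Ioo (0 : ℝ) 1, ENNReal.ofReal r * ENNReal.ofReal (1 - r ^ 2) *
      ENNReal.ofReal r ^ (2 * n) = ENNReal.ofReal (1 / (2 * (n + 1) * (n + 2))) := by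
  have h1 : ∀ r ∈ Set.Ioo (0 : ℝ) 1, ENNReal.ofReal r * ENNReal.ofReal (1 - r ^ 2) *
      ENNReal.ofReal r ^ (2 * n) = ENNReal.ofReal (r ^ (2 * n + 1) - r ^ (2 * n + 3)) := by
    intro r hr
    rw [← ENNReal.ofReal_mul hr.1.le, ← ENNReal.ofReal_pow hr.1.le, ← ENNReal.ofReal_mul']
    · congr 1; ring
    · exact pow_nonneg hr.1.le _
  have hcont : Continuous fun r : ℝ => r ^ (2 * n + 1) - r ^ (2 * n + 3) := by fun_prop
  rw [setLIntegral_congr_fun measurableSet_Ioo h1, ← ofReal_integral_eq_lintegral_ofReal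
    ((hcont.integrableOn_Icc (μ := volume)).mono_set Set.Ioo_subset_Icc_self)]
  · rw [← integral_Ioc_eq_integral_Ioo, ← intervalIntegral.integral_of_le zero_le_one,
      intervalIntegral.integral_sub (by simp) (by simp)]
    simp only [integral_pow]
    congr 1
    push_cast
    have : (n : ℝ) + 1 ≠ 0 := by positivity
    have : (n : ℝ) + 2 ≠ 0 := by positivity
    have : 2 * (n : ℝ) + 1 + 1 ≠ 0 := by positivity
    have : 2 * (n : ℝ) + 3 + 1 ≠ 0 := by positivity
    field_simp
    ring
  · refine (ae_restrict_iff' measurableSet_Ioo).2 (Eventually.of_forall fun r hr => ?_)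
    have := pow_le_pow_of_le_one hr.1.le hr.2.le (show 2 * n + 1 ≤ 2 * n + 3 by omega)
    simpa using this

/-- One half of the Littlewood-Paley estimate. -/
lemma hardyNormSq_le {g : ℂ → ℂ} (hg : DifferentiableOn ℂ g disc) (hg0 : g 0 = 0) :
    hardyNormSq g ≤ ENNReal.ofReal (2 / Real.pi) *
      ∫⁻ z in disc, ‖deriv g z‖ₑ ^ 2 * ENNReal.ofReal (1 - ‖z‖ ^ 2) := by
  have hg' : DifferentiableOn ℂ (deriv g) disc := hg.deriv isOpen_disc
  have hc0 : taylorCoeff g 0 = 0 := by simp [taylorCoeff, hg0]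
  have hint : ∫⁻ r in Set.Ioo (0 : ℝ) 1, ENNReal.ofReal r * ENNReal.ofReal (1 - r ^ 2) *
      integralMeanSq (deriv g) r =
      ∑' n : ℕ, ‖taylorCoeff (deriv g) n‖ₑ ^ 2 * ENNReal.ofReal (1 / (2 * (n + 1) * (n + 2))) := by
    simp_rw [← lintegral_pow_mul_one_sub_sq]
    rw [setLIntegral_congr_fun measurableSet_Ioo (g := fun r => ∑' n : ℕ,
      ‖taylorCoeff (deriv g) n‖ₑ ^ 2 * (ENNReal.ofReal r * ENNReal.ofReal (1 - r ^ 2) *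
        ENNReal.ofReal r ^ (2 * n)))]
    · rw [lintegral_tsum fun n => by fun_prop]
      congr 1; ext n
      rw [lintegral_const_mul _ (by fun_prop)]
    · intro r hr
      simp only
      rw [integralMeanSq_eq_tsum_taylorCoeff hg' hr.1.le hr.2, ← ENNReal.tsum_mul_left]
      congr 1; ext n; ring
  rw [lintegral_disc_eq hg'.continuousOn (W := fun r => ENNReal.ofReal (1 - r ^ 2))
    (by fun_prop), hint, ← mul_assoc, ← ENNReal.ofReal_mul (by positivity)]
  have h4 : 2 / Real.pi * (2 * Real.pi) = 4 := by field_simp; norm_num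
  rw [h4, hardyNormSq]
  refine limsup_le_of_le (by isBoundedDefault) ?_
  filter_upwards [Ioo_mem_nhdsLT (show (0 : ℝ) < 1 by norm_num)] with r hr
  rw [integralMeanSq_eq_tsum_taylorCoeff hg hr.1.le hr.2, tsum_eq_zero_add' ENNReal.summable, hc0,
    ← ENNReal.tsum_mul_left]
  simp only [enorm_zero, ne_eq, OfNat.ofNat_ne_zero, not_false_eq_true, zero_pow, zero_mul, zero_add]
  refine ENNReal.tsum_le_tsum fun n => ?_
  have hr1 : ENNReal.ofReal r ^ (2 * (n + 1)) ≤ 1 :=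
    pow_le_one₀ (by simp) (ENNReal.ofReal_le_one.2 hr.2.le)
  have hn : ‖(n + 1 : ℂ)‖ₑ = ENNReal.ofReal (n + 1) := by
    rw [← ofReal_norm]
    congr 1
    exact_mod_cast Complex.norm_natCast (n + 1)
  calc _ ≤ ‖taylorCoeff g (n + 1)‖ₑ ^ 2 * 1 := by gcongr
    -- The inserted factor is `2(n+1)/(n+2) ≥ 1`, with equality at `n = 0`; its part `(n+1)²` turns
    -- coefficients of `g` into those of `g'`.
    _ ≤ ‖taylorCoeff g (n + 1)‖ₑ ^ 2 *
        ENNReal.ofReal (4 * (n + 1) ^ 2 * (1 / (2 * (n + 1) * (n + 2)))) := by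
      gcongr
      rw [ENNReal.one_le_ofReal]
      have : (0 : ℝ) ≤ n := n.cast_nonneg
      rw [mul_one_div, le_div_iff₀ (by positivity)]
      nlinarith
    _ = _ := by
      rw [taylorCoeff_deriv, enorm_mul, hn, ENNReal.ofReal_mul (by positivity),
        ENNReal.ofReal_mul (by positivity), ENNReal.ofReal_pow (by positivity)]
      ring

/-! ### Disc automorphisms and the conformal change of variables -/

lemma one_sub_conj_mul_ne_zero {a z : ℂ} (ha : a ∈ disc) (hz : z ∈ disc) :
    1 - conj a * z ≠ 0 := by
  rw [mem_disc] at ha hz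
  intro h
  have h1 : ‖conj a * z‖ = 1 := by rw [← sub_eq_zero.1 h, norm_one]
  rw [norm_mul, RCLike.norm_conj] at h1
  nlinarith [norm_nonneg a, norm_nonneg z]

lemma one_sub_norm_phi_sq {a z : ℂ} (ha : a ∈ disc) (hz : z ∈ disc) :
    1 - ‖phi a z‖ ^ 2 = (1 - ‖a‖ ^ 2) * (1 - ‖z‖ ^ 2) * ‖(1 - conj a * z)⁻¹‖ ^ 2 := by
  have h : ‖1 - conj a * z‖ ≠ 0 := norm_ne_zero_iff.2 (one_sub_conj_mul_ne_zero ha hz)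
  have key : ‖1 - conj a * z‖ ^ 2 - ‖a - z‖ ^ 2 = (1 - ‖a‖ ^ 2) * (1 - ‖z‖ ^ 2) := by
    simp only [← Complex.normSq_eq_norm_sq, Complex.normSq_apply, Complex.sub_re, Complex.sub_im,
      Complex.mul_re, Complex.mul_im, Complex.conj_re, Complex.conj_im, Complex.one_re,
      Complex.one_im]
    ring
  rw [phi, norm_div, norm_inv, ← key, inv_pow, div_pow, ← div_eq_mul_inv, sub_div,
    div_self (pow_ne_zero 2 h)]

lemma phi_mem_disc {a z : ℂ} (ha : a ∈ disc) (hz : z ∈ disc) : phi a z ∈ disc := by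
  have h := one_sub_norm_phi_sq ha hz
  have h0 := norm_pos_iff.2 (inv_ne_zero (one_sub_conj_mul_ne_zero ha hz))
  rw [mem_disc] at *
  have h1 : 0 < 1 - ‖a‖ ^ 2 := by nlinarith [norm_nonneg a]
  have h2 : 0 < 1 - ‖z‖ ^ 2 := by nlinarith [norm_nonneg z]
  have h3 : 0 < 1 - ‖phi a z‖ ^ 2 := by rw [h]; positivity
  nlinarith [norm_nonneg (phi a z)]

lemma phi_phi {a z : ℂ} (ha : a ∈ disc) (hz : z ∈ disc) : phi a (phi a z) = z := by
  have h1 := one_sub_conj_mul_ne_zero ha hz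
  have h2 := one_sub_conj_mul_ne_zero ha (phi_mem_disc ha hz)
  rw [phi, div_eq_iff h2, phi]
  generalize hd : 1 - conj a * z = d at h1
  field_simp
  rw [← hd]
  ring

lemma image_phi_disc {a : ℂ} (ha : a ∈ disc) : phi a '' disc = disc := by
  ext z
  constructor
  · rintro ⟨w, hw, rfl⟩
    exact phi_mem_disc ha hw
  · exact fun hz => ⟨phi a z, phi_mem_disc ha hz, phi_phi ha hz⟩

lemma injOn_phi {a : ℂ} (ha : a ∈ disc) : Set.InjOn (phi a) disc := fun z hz w hw h => by
  rw [← phi_phi ha hz, h, phi_phi ha hw]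

lemma phi_zero (a : ℂ) : phi a 0 = a := by simp [phi]

lemma differentiableOn_phi {a : ℂ} (ha : a ∈ disc) : DifferentiableOn ℂ (phi a) disc := by
  intro z hz
  have := one_sub_conj_mul_ne_zero ha hz
  unfold phi
  fun_prop (disch := assumption)

/-- The conformal change of variables `w = φ_a(z)`. -/
lemma lintegral_deriv_phi_mul {a : ℂ} (ha : a ∈ disc) (G : ℂ → ℝ≥0∞) :
    ∫⁻ z in disc, ‖deriv (phi a) z‖ₑ ^ 2 * G (phi a z) = ∫⁻ w in disc, G w := by
  have hd : ∀ z ∈ disc, HasFDerivWithinAt (phi a)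
      ((ContinuousLinearMap.toSpanSingleton ℂ (deriv (phi a) z)).restrictScalars ℝ) disc z := by
    intro z hz
    have := ((differentiableOn_phi ha).differentiableAt (isOpen_disc.mem_nhds hz)).hasDerivAt
    exact (this.hasFDerivAt.restrictScalars ℝ).hasFDerivWithinAt
  have := lintegral_image_eq_lintegral_abs_det_fderiv_mul volume isOpen_disc.measurableSet hd
    (injOn_phi ha) G
  rw [image_phi_disc ha] at this
  rw [this]
  congr 1; ext z
  congr 1
  -- The real Jacobian of multiplication by a complex number is its squared modulus.
  rw [← ofReal_norm, ← ENNReal.ofReal_pow (norm_nonneg _)]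
  simp [ContinuousLinearMap.det, LinearMap.det_restrictScalars, Algebra.norm_complex_eq,
    Complex.normSq_eq_norm_sq]

/-- Littlewood-Paley applied to `g_a`, whose derivative is `f'(φ_a) φ_a'`. Because `φ_a` is an
involution, substituting `w = φ_a(z)` moves the automorphism from `f'` to the weight. -/
lemma hardyNormSq_gFun_le {f : ℂ → ℂ} (hf : DifferentiableOn ℂ f disc) {a : ℂ} (ha : a ∈ disc) :
    hardyNormSq (gFun f a) ≤ ENNReal.ofReal (2 / Real.pi) *
      ∫⁻ z in disc, ‖deriv f z‖ₑ ^ 2 * ENNReal.ofReal (1 - ‖phi a z‖ ^ 2) := by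
  have hphi := differentiableOn_phi ha
  have hg : DifferentiableOn ℂ (gFun f a) disc :=
    (hf.comp hphi fun _ hz => phi_mem_disc ha hz).sub_const _
  refine (hardyNormSq_le hg (by simp [gFun, phi_zero])).trans (le_of_eq ?_)
  congr 1
  rw [← lintegral_deriv_phi_mul ha
    (fun w => ‖deriv f w‖ₑ ^ 2 * ENNReal.ofReal (1 - ‖phi a w‖ ^ 2))]
  refine setLIntegral_congr_fun isOpen_disc.measurableSet fun z hz => ?_
  have h1 := (hf.differentiableAt (isOpen_disc.mem_nhds (phi_mem_disc ha hz))).hasDerivAt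
  have h2 := (hphi.differentiableAt (isOpen_disc.mem_nhds hz)).hasDerivAt
  have h3 : deriv (gFun f a) z = deriv f (phi a z) * deriv (phi a) z :=
    ((h1.comp z h2).sub_const _).deriv
  rw [h3, phi_phi ha hz, enorm_mul]
  ring

/-! ### Radial majorants of the first derivative and VMOA -/

lemma integralMeanSq_inv_one_sub_conj_mul {a : ℂ} (ha : a ∈ disc) {r : ℝ} (hr : 0 ≤ r)
    (hr1 : r < 1) :
    integralMeanSq (fun z => (1 - conj a * z)⁻¹) r =
      ENNReal.ofReal (1 / (1 - ‖a‖ ^ 2 * r ^ 2)) := by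
  rw [mem_disc] at ha
  have hlt : ‖a‖ * r < 1 := by nlinarith [norm_nonneg a]
  have h0 : 0 ≤ ‖a‖ * r := by positivity
  rw [integralMeanSq_eq_tsum (c := fun n => conj a ^ n) hr]
  · have : ∀ n : ℕ, ‖conj a ^ n‖ₑ ^ 2 * ENNReal.ofReal r ^ (2 * n) =
        ENNReal.ofReal (‖a‖ ^ 2 * r ^ 2) ^ n := by
      intro n
      rw [← ofReal_norm, norm_pow, RCLike.norm_conj, ← ENNReal.ofReal_pow (by positivity),
        ← ENNReal.ofReal_pow (by positivity), ← ENNReal.ofReal_pow (by positivity),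
        ← ENNReal.ofReal_mul (by positivity)]
      congr 1; ring
    simp_rw [this]
    rw [ENNReal.tsum_geometric, one_div, ENNReal.ofReal_inv_of_pos (by nlinarith),
      ENNReal.ofReal_sub _ (by positivity), ENNReal.ofReal_one]
  · simp only [norm_pow, RCLike.norm_conj, ← mul_pow]
    exact summable_geometric_of_lt_one h0 hlt
  · intro z hz
    simp only [← mul_pow]
    exact hasSum_geometric_of_norm_lt_one (by rwa [norm_mul, RCLike.norm_conj, hz])

/-- Once `|f'|` is replaced by a radial majorant, `1 - |φ_a|²` depends on the angle only through `|1
- conj a z|⁻²`, whose circular mean is explicit by the geometric series. -/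
lemma lintegral_disc_le_of_norm_deriv_le {f : ℂ → ℂ} {N : ℝ → ℝ} (hN : Measurable N)
    (hfN : ∀ z ∈ disc, ‖deriv f z‖ ≤ N ‖z‖) {a : ℂ} (ha : a ∈ disc) :
    ∫⁻ z in disc, ‖deriv f z‖ₑ ^ 2 * ENNReal.ofReal (1 - ‖phi a z‖ ^ 2) ≤
      ENNReal.ofReal (2 * Real.pi) * ∫⁻ r in Set.Ioo (0 : ℝ) 1,
        ENNReal.ofReal (N r ^ 2 * (1 - r ^ 2)) *
          ENNReal.ofReal ((1 - ‖a‖ ^ 2) / (1 - ‖a‖ ^ 2 * r ^ 2)) := by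
  have ha1 := mem_disc.1 ha
  have ha2 : 0 ≤ 1 - ‖a‖ ^ 2 := by nlinarith [norm_nonneg a]
  have hcont : ContinuousOn (fun z => (1 - conj a * z)⁻¹) disc := by
    intro z hz
    have := one_sub_conj_mul_ne_zero ha hz
    exact ContinuousAt.continuousWithinAt (by fun_prop (disch := assumption))
  calc _ ≤ ∫⁻ z in disc, ‖(1 - conj a * z)⁻¹‖ₑ ^ 2 *
        ENNReal.ofReal (N ‖z‖ ^ 2 * ((1 - ‖a‖ ^ 2) * (1 - ‖z‖ ^ 2))) := by
        refine setLIntegral_mono' isOpen_disc.measurableSet fun z hz => ?_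
        have hz1 := mem_disc.1 hz
        have hz2 : 0 ≤ 1 - ‖z‖ ^ 2 := by nlinarith [norm_nonneg z]
        rw [one_sub_norm_phi_sq ha hz, ← ofReal_norm, ← ofReal_norm,
          ← ENNReal.ofReal_pow (norm_nonneg _), ← ENNReal.ofReal_pow (norm_nonneg _),
          ← ENNReal.ofReal_mul (by positivity), ← ENNReal.ofReal_mul (by positivity)]
        refine ENNReal.ofReal_le_ofReal ?_
        have := pow_le_pow_left₀ (norm_nonneg _) (hfN z hz) 2
        calc _ ≤ N ‖z‖ ^ 2 * ((1 - ‖a‖ ^ 2) * (1 - ‖z‖ ^ 2) * ‖(1 - conj a * z)⁻¹‖ ^ 2) := by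
              gcongr
          _ = _ := by ring
    _ = _ := lintegral_disc_eq hcont
        (W := fun r => ENNReal.ofReal (N r ^ 2 * ((1 - ‖a‖ ^ 2) * (1 - r ^ 2)))) (by fun_prop)
    _ ≤ _ := by
        gcongr ENNReal.ofReal (2 * Real.pi) * ?_
        refine setLIntegral_mono' measurableSet_Ioo fun r hr => ?_
        have hr2 : 0 ≤ 1 - r ^ 2 := by nlinarith [hr.1, hr.2]
        have har : 0 < 1 - ‖a‖ ^ 2 * r ^ 2 := by
          have : r ^ 2 < 1 := by nlinarith [hr.1, hr.2]
          nlinarith [sq_nonneg r, sq_nonneg ‖a‖]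
        rw [integralMeanSq_inv_one_sub_conj_mul ha hr.1.le hr.2]
        -- The Jacobian factor `r` of polar coordinates is bounded by 1.
        calc _ ≤ 1 * ENNReal.ofReal (N r ^ 2 * ((1 - ‖a‖ ^ 2) * (1 - r ^ 2))) *
              ENNReal.ofReal (1 / (1 - ‖a‖ ^ 2 * r ^ 2)) := by
              gcongr
              exact ENNReal.ofReal_le_one.2 hr.2.le
          _ = _ := by
              rw [one_mul, ← ENNReal.ofReal_mul (by positivity),
                ← ENNReal.ofReal_mul (by positivity)]
              congr 1; ring

lemma tendsto_lintegral_mul_quotient {w : ℝ → ℝ} (hw : Measurable w)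
    (hfin : ∫⁻ r in Set.Ioo (0 : ℝ) 1, ENNReal.ofReal (w r) ≠ ∞) :
    Tendsto (fun s : ℝ => ∫⁻ r in Set.Ioo (0 : ℝ) 1,
      ENNReal.ofReal (w r) * ENNReal.ofReal ((1 - s ^ 2) / (1 - s ^ 2 * r ^ 2)))
      (𝓝[<] 1) (𝓝 0) := by
  rw [← lintegral_zero (μ := volume.restrict (Set.Ioo (0 : ℝ) 1))]
  have hs : ∀ᶠ s : ℝ in 𝓝[<] 1, s ∈ Set.Ioo (0 : ℝ) 1 := Ioo_mem_nhdsLT zero_lt_one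
  refine tendsto_lintegral_filter_of_dominated_convergence (fun r => ENNReal.ofReal (w r))
    (Eventually.of_forall fun s => by fun_prop) ?_ hfin ?_
  · filter_upwards [hs] with s hs
    refine (ae_restrict_iff' measurableSet_Ioo).2 (Eventually.of_forall fun r hr => ?_)
    refine mul_le_of_le_one_right' (ENNReal.ofReal_le_one.2 (div_le_one_of_le₀ ?_ ?_))
    · have : r ^ 2 ≤ 1 := by nlinarith [hr.1, hr.2]
      nlinarith [sq_nonneg s]
    · have : r ^ 2 ≤ 1 := by nlinarith [hr.1, hr.2]
      have : s ^ 2 ≤ 1 := by nlinarith [hs.1, hs.2]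
      nlinarith [sq_nonneg s]
  · refine (ae_restrict_iff' measurableSet_Ioo).2 (Eventually.of_forall fun r hr => ?_)
    have hr1 : (1 : ℝ) - 1 ^ 2 * r ^ 2 ≠ 0 := by nlinarith [hr.1, hr.2]
    have : Tendsto (fun s : ℝ => (1 - s ^ 2) / (1 - s ^ 2 * r ^ 2)) (𝓝[<] 1) (𝓝 0) := by
      have hc : ContinuousAt (fun s : ℝ => (1 - s ^ 2) / (1 - s ^ 2 * r ^ 2)) 1 := by
        fun_prop (disch := assumption)
      simpa using hc.tendsto.mono_left nhdsWithin_le_nhds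
    simpa using ENNReal.Tendsto.const_mul (ENNReal.tendsto_ofReal this)
      (Or.inr ENNReal.ofReal_ne_top)

/-- A radial majorant `N` of `f'` with `∫₀¹ N(r)² (1 - r²) dr < ∞` forces `f ∈ VMOA`. -/
lemma isVMOA_of_norm_deriv_le {f : ℂ → ℂ} (hf : DifferentiableOn ℂ f disc) {N : ℝ → ℝ}
    (hN : Measurable N) (hfN : ∀ z ∈ disc, ‖deriv f z‖ ≤ N ‖z‖)
    (hfin : ∫⁻ r in Set.Ioo (0 : ℝ) 1, ENNReal.ofReal (N r ^ 2 * (1 - r ^ 2)) ≠ ∞) :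
    IsVMOA f := by
  refine ⟨hf, ?_⟩
  have hlim := (tendsto_lintegral_mul_quotient
    (w := fun r => N r ^ 2 * (1 - r ^ 2)) (by fun_prop) hfin).comp
    (tendsto_comap (f := fun a : ℂ => ‖a‖) (x := 𝓝[<] (1 : ℝ)))
  have hlim' := ENNReal.Tendsto.const_mul (a := ENNReal.ofReal (2 / Real.pi))
    (ENNReal.Tendsto.const_mul (a := ENNReal.ofReal (2 * Real.pi)) hlim
      (Or.inr ENNReal.ofReal_ne_top)) (Or.inr ENNReal.ofReal_ne_top)
  simp only [mul_zero] at hlim'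
  refine tendsto_of_tendsto_of_tendsto_of_le_of_le' tendsto_const_nhds hlim'
    (Eventually.of_forall fun _ => zero_le) ?_
  have hmem : ∀ᶠ a : ℂ in comap (fun a : ℂ => ‖a‖) (𝓝[<] (1 : ℝ)), a ∈ disc := by
    filter_upwards [preimage_mem_comap (self_mem_nhdsWithin (a := (1 : ℝ)))] with a ha
    exact mem_disc.2 ha
  filter_upwards [hmem] with a ha
  refine (hardyNormSq_gFun_le hf ha).trans ?_
  gcongr
  exact lintegral_disc_le_of_norm_deriv_le hN hfN ha

/-! ### Continuity of the maximum modulus -/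

lemma maxModulus_nonneg (r : ℝ) (A : ℂ → ℂ) : 0 ≤ maxModulus r A :=
  Real.sSup_nonneg (by rintro _ ⟨z, -, rfl⟩; exact norm_nonneg _)

lemma norm_le_maxModulus {A : ℂ → ℂ} (hA : ContinuousOn A disc) {z : ℂ} (hz : z ∈ disc) :
    ‖A z‖ ≤ maxModulus ‖z‖ A := by
  have hsub : Metric.sphere (0 : ℂ) ‖z‖ ⊆ disc := fun w hw =>
    mem_disc.2 ((mem_sphere_zero_iff_norm.1 hw).trans_lt (mem_disc.1 hz))
  refine le_csSup ?_ ⟨z, by simp, rfl⟩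
  exact ((isCompact_sphere 0 ‖z‖).image_of_continuousOn (hA.norm.mono hsub)).bddAbove

/-- After rescaling to the unit sphere, this is a supremum over a fixed compact set. The even
extension `|t|` makes 0 an interior point, so two-sided derivatives of integrals are available even
when the base point is 0. -/
lemma continuousOn_maxModulus_abs {A : ℂ → ℂ} (hA : ContinuousOn A disc) :
    ContinuousOn (fun t : ℝ => maxModulus |t| A) (Set.Ioo (-1) 1) := by
  rw [continuousOn_iff_continuous_domRestrict]
  have hmem : ∀ p : Set.Ioo (-1 : ℝ) 1 × Metric.sphere (0 : ℂ) 1,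
      (|p.1.1| : ℝ) • p.2.1 ∈ disc := by
    intro p
    rw [mem_disc, norm_smul, mem_sphere_zero_iff_norm.1 p.2.2]
    simpa using abs_lt.2 p.1.2
  have hcont : Continuous ↿(fun (t : Set.Ioo (-1 : ℝ) 1) (u : Metric.sphere (0 : ℂ) 1) =>
      ‖A ((|t.1| : ℝ) • u.1)‖) :=
    (hA.comp_continuous (f := fun p : Set.Ioo (-1 : ℝ) 1 × Metric.sphere (0 : ℂ) 1 =>
      (|p.1.1| : ℝ) • p.2.1) (by fun_prop) hmem).norm
  convert isCompact_univ.continuous_sSup hcont using 2 with t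
  simp only [Set.domRestrict_apply, maxModulus]
  have hs : Metric.sphere (0 : ℂ) |t.1| = (|t.1| : ℝ) • Metric.sphere (0 : ℂ) 1 := by
    simp [smul_sphere]
  rw [hs]
  congr 1
  ext x
  simp [Set.mem_smul_set]

/-! ### Grönwall's inequality and the growth of solutions -/

lemma hasDerivAt_integral_of_continuousOn {k : ℝ → ℝ} (hk : ContinuousOn k (Set.Ioo (-1) 1))
    {a x : ℝ} (ha : a ∈ Set.Ioo (-1 : ℝ) 1) (hx : x ∈ Set.Ioo (-1 : ℝ) 1) :
    HasDerivAt (fun u => ∫ t in a..u, k t) (k x) x :=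
  intervalIntegral.integral_hasDerivAt_right
    (hk.mono (Set.OrdConnected.uIcc_subset Set.ordConnected_Ioo ha hx)).intervalIntegrable
    (hk.stronglyMeasurableAtFilter isOpen_Ioo x hx) (hk.continuousAt (isOpen_Ioo.mem_nhds hx))

/-- Grönwall's inequality in integral form. -/
lemma le_mul_exp_of_le_add_integral {k φ : ℝ → ℝ} (hk : ContinuousOn k (Set.Ioo (-1) 1))
    (hφ : ContinuousOn φ (Set.Ioo (-1) 1)) {a C : ℝ} (ha : a ∈ Set.Ioo (-1 : ℝ) 1)
    (hk0 : ∀ t ∈ Set.Ico a 1, 0 ≤ k t)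
    (h : ∀ r ∈ Set.Ico a 1, φ r ≤ C + ∫ t in a..r, k t * φ t) {r : ℝ} (hr : r ∈ Set.Ico a 1) :
    φ r ≤ C * Real.exp (∫ t in a..r, k t) := by
  have hsub : Set.Icc a r ⊆ Set.Ioo (-1) 1 := fun x hx => ⟨ha.1.trans_le hx.1, hx.2.trans_lt hr.2⟩
  have hd : ∀ x ∈ Set.Icc a r, HasDerivAt
      (fun x => (C + ∫ t in a..x, k t * φ t) * Real.exp (-∫ t in a..x, k t))
      (k x * φ x * Real.exp (-∫ t in a..x, k t) +
        (C + ∫ t in a..x, k t * φ t) * (Real.exp (-∫ t in a..x, k t) * -k x)) x := fun x hx =>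
    ((hasDerivAt_integral_of_continuousOn (hk.mul hφ) ha (hsub hx)).const_add C).mul
      (hasDerivAt_integral_of_continuousOn hk ha (hsub hx)).fun_neg.exp
  -- The integrating factor `exp(-∫ k)` makes the right-hand side of `h` nonincreasing.
  have hanti : AntitoneOn
      (fun x => (C + ∫ t in a..x, k t * φ t) * Real.exp (-∫ t in a..x, k t)) (Set.Icc a r) := by
    refine antitoneOn_of_deriv_nonpos (convex_Icc a r)
      (fun x hx => (hd x hx).continuousAt.continuousWithinAt)
      (fun x hx => (hd x (interior_subset hx)).differentiableAt.differentiableWithinAt)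
      fun x hx => ?_
    have hx' := interior_subset hx
    have hx1 : x ∈ Set.Ico a 1 := ⟨hx'.1, hx'.2.trans_lt hr.2⟩
    rw [(hd x hx').deriv]
    have h1 := mul_le_mul_of_nonneg_left (h x hx1) (hk0 x hx1)
    have h2 := mul_le_mul_of_nonneg_right h1 (Real.exp_pos (-∫ t in a..x, k t)).le
    linarith
  have h1 := hanti (Set.left_mem_Icc.2 hr.1) (Set.right_mem_Icc.2 hr.1) hr.1
  simp only [intervalIntegral.integral_same, add_zero, neg_zero, Real.exp_zero, mul_one] at h1
  calc φ r ≤ C + ∫ t in a..r, k t * φ t := h r hr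
    _ = ((C + ∫ t in a..r, k t * φ t) * Real.exp (-∫ t in a..r, k t)) *
        Real.exp (∫ t in a..r, k t) := by
      rw [mul_assoc, ← Real.exp_add, neg_add_cancel, Real.exp_zero, mul_one]
    _ ≤ _ := by gcongr

lemma ofReal_mul_mem_disc {u : ℂ} (hu : ‖u‖ = 1) {t : ℝ} (ht : t ∈ Set.Ioo (-1 : ℝ) 1) :
    (t : ℂ) * u ∈ disc := by
  rw [mem_disc, norm_mul, hu, mul_one, Complex.norm_real]
  exact abs_lt.2 ht

lemma hasDerivAt_comp_ofReal_mul {g : ℂ → ℂ} (hg : DifferentiableOn ℂ g disc) {u : ℂ}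
    (hu : ‖u‖ = 1) {t : ℝ} (ht : t ∈ Set.Ioo (-1 : ℝ) 1) :
    HasDerivAt (fun t : ℝ => g (t * u)) (u * deriv g (t * u)) t := by
  have h1 := (hg.differentiableAt (isOpen_disc.mem_nhds (ofReal_mul_mem_disc hu ht))).hasDerivAt
  have h2 : HasDerivAt (fun t : ℝ => (t : ℂ) * u) u t := by
    simpa using (Complex.ofRealCLM.hasDerivAt (x := t)).mul_const u
  rw [mul_comm]
  exact h1.comp t h2

lemma exists_norm_le_of_norm_le {g : ℂ → ℂ} (hg : DifferentiableOn ℂ g disc) {a : ℝ} (ha : a < 1) :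
    ∃ C, ∀ z : ℂ, ‖z‖ ≤ a → ‖g z‖ ≤ C := by
  obtain ⟨C, hC⟩ := (isCompact_closedBall (0 : ℂ) a).exists_bound_of_continuousOn
    (hg.continuousOn.mono (Metric.closedBall_subset_ball ha))
  exact ⟨C, fun z hz => hC z (by simpa using hz)⟩

/-- Growth estimate for the solutions of `f'' + A f = 0`. -/
lemma exists_norm_solution_le {A f : ℂ → ℂ} (hA : DifferentiableOn ℂ A disc)
    (hf : IsSolution A f) {a : ℝ} (ha0 : 0 ≤ a) (ha1 : a < 1) :
    ∃ C, ∀ u : ℂ, ‖u‖ = 1 → ∀ r ∈ Set.Ico a 1,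
      ‖f (r * u)‖ ≤ C * Real.exp (∫ t in a..r, maxModulus |t| A * (1 - t)) := by
  have hf' : DifferentiableOn ℂ (deriv f) disc := hf.1.deriv isOpen_disc
  have ha : a ∈ Set.Ioo (-1 : ℝ) 1 := ⟨by linarith, ha1⟩
  have hk : ContinuousOn (fun t : ℝ => maxModulus |t| A * (1 - t)) (Set.Ioo (-1) 1) :=
    (continuousOn_maxModulus_abs hA.continuousOn).mul (by fun_prop)
  obtain ⟨C₀, hC₀⟩ := exists_norm_le_of_norm_le hf.1 ha1
  obtain ⟨C₁, hC₁⟩ := exists_norm_le_of_norm_le hf' ha1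
  refine ⟨C₀ + C₁, fun u hu r hr => ?_⟩
  have hφ : ContinuousOn (fun t : ℝ => ‖f (t * u)‖) (Set.Ioo (-1) 1) := fun t ht =>
    (hasDerivAt_comp_ofReal_mul hf.1 hu ht).continuousAt.continuousWithinAt.norm
  refine le_mul_exp_of_le_add_integral (φ := fun t : ℝ => ‖f (t * u)‖) hk hφ ha
    (fun t ht => mul_nonneg (maxModulus_nonneg _ _) (by linarith [ht.2])) ?_ hr
  intro s hs
  have hsub : Set.Icc a s ⊆ Set.Ioo (-1) 1 := fun x hx => ⟨ha.1.trans_le hx.1, hx.2.trans_lt hs.2⟩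
  -- `p t` is the first Taylor polynomial of `t ↦ f (t u)` based at `t` and evaluated at `s`
  set p : ℝ → ℂ := fun t => f (t * u) + ((s - t : ℝ) : ℂ) * (u * deriv f (t * u)) with hp
  -- The terms in `f'` cancel, so one integration of `p'` does the work of integrating `f''` twice
  -- and produces the weight `s - t`.
  have hpd : ∀ t ∈ Set.Icc a s, HasDerivAt p
      (((s - t : ℝ) : ℂ) * (u * (u * deriv (deriv f) (t * u)))) t := by
    intro t ht
    have h1 := hasDerivAt_comp_ofReal_mul hf.1 hu (hsub ht)
    have h2 := (hasDerivAt_comp_ofReal_mul hf' hu (hsub ht)).const_mul u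
    have h3 : HasDerivAt (fun t : ℝ => ((s - t : ℝ) : ℂ)) (-1) t := by
      simpa using ((hasDerivAt_id t).const_sub s).ofReal_comp
    refine (h1.fun_add (h3.fun_mul h2)).congr_deriv ?_
    ring
  have hB : ∀ t ∈ Set.Icc a s, HasDerivAt
      (fun r => C₀ + C₁ + ∫ t in a..r, maxModulus |t| A * (1 - t) * ‖f (t * u)‖)
      (maxModulus |t| A * (1 - t) * ‖f (t * u)‖) t := fun t ht =>
    (hasDerivAt_integral_of_continuousOn (hk.mul hφ) ha (hsub ht)).const_add _
  have hau : ‖(a : ℂ) * u‖ ≤ a := by simp [hu, abs_of_nonneg ha0]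
  have hmain := image_norm_le_of_norm_deriv_right_le_deriv_boundary' (f := p)
    (fun t ht => (hpd t ht).continuousAt.continuousWithinAt)
    (fun t ht => (hpd t (Set.Ico_subset_Icc_self ht)).hasDerivWithinAt)
    (B := fun r => C₀ + C₁ + ∫ t in a..r, maxModulus |t| A * (1 - t) * ‖f (t * u)‖)
    ?_ (fun t ht => (hB t ht).continuousAt.continuousWithinAt)
    (fun t ht => (hB t (Set.Ico_subset_Icc_self ht)).hasDerivWithinAt) ?_
    (Set.right_mem_Icc.2 hs.1)
  · simpa [hp] using hmain
  -- At `t = a` the bound `C₀ + C₁` suffices because `s - a ≤ 1`.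
  · simp only [hp, intervalIntegral.integral_same, add_zero]
    refine (norm_add_le _ _).trans (add_le_add (hC₀ _ hau) ?_)
    rw [norm_mul, norm_mul, hu, one_mul, Complex.norm_real, Real.norm_eq_abs,
      abs_of_nonneg (sub_nonneg.2 hs.1)]
    have h1 := hC₁ _ hau
    have h2 := norm_nonneg (deriv f (a * u))
    nlinarith [hs.2]
  · intro t ht
    have ht' := hsub (Set.Ico_subset_Icc_self ht)
    have hz := ofReal_mul_mem_disc hu ht'
    have heq : deriv (deriv f) (t * u) = -(A (t * u) * f (t * u)) :=
      eq_neg_of_add_eq_zero_left (hf.2 _ hz)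
    have hAz := norm_le_maxModulus hA.continuousOn hz
    rw [norm_mul, hu, mul_one, Complex.norm_real, Real.norm_eq_abs] at hAz
    rw [heq, norm_mul, norm_mul, norm_mul, norm_neg, norm_mul, hu, one_mul, one_mul,
      Complex.norm_real, Real.norm_eq_abs, abs_of_nonneg (sub_nonneg.2 ht.2.le)]
    -- Enlarging `s - t` to `1 - t` makes the kernel independent of `s`, as Grönwall requires.
    calc (s - t) * (‖A (t * u)‖ * ‖f (t * u)‖)
        ≤ (1 - t) * (maxModulus |t| A * ‖f (t * u)‖) := by
          gcongr
          · linarith [ht'.2]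
          · exact hs.2.le
      _ = _ := by ring

/-- Integrating a radial majorant of `g'`. -/
lemma norm_le_add_integral {g : ℂ → ℂ} (hg : DifferentiableOn ℂ g disc) {h : ℝ → ℝ}
    (hh : ContinuousOn h (Set.Ioo (-1) 1)) {a C : ℝ} (ha0 : 0 ≤ a) (ha1 : a < 1)
    (hC : ∀ z : ℂ, ‖z‖ ≤ a → ‖g z‖ ≤ C) {u : ℂ} (hu : ‖u‖ = 1)
    (hgh : ∀ t ∈ Set.Ico a 1, ‖deriv g (t * u)‖ ≤ h t) {r : ℝ} (hr : r ∈ Set.Ico a 1) :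
    ‖g (r * u)‖ ≤ C + ∫ t in a..r, h t := by
  have ha : a ∈ Set.Ioo (-1 : ℝ) 1 := ⟨by linarith, ha1⟩
  have hsub : Set.Icc a r ⊆ Set.Ioo (-1) 1 := fun x hx => ⟨ha.1.trans_le hx.1, hx.2.trans_lt hr.2⟩
  have hd : ∀ t ∈ Set.Icc a r, HasDerivAt (fun t : ℝ => g (t * u)) (u * deriv g (t * u)) t :=
    fun t ht => hasDerivAt_comp_ofReal_mul hg hu (hsub ht)
  have hB : ∀ t ∈ Set.Icc a r, HasDerivAt (fun r => C + ∫ t in a..r, h t) (h t) t := fun t ht =>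
    (hasDerivAt_integral_of_continuousOn hh ha (hsub ht)).const_add _
  refine image_norm_le_of_norm_deriv_right_le_deriv_boundary' (f := fun t : ℝ => g (t * u))
    (fun t ht => (hd t ht).continuousAt.continuousWithinAt)
    (fun t ht => (hd t (Set.Ico_subset_Icc_self ht)).hasDerivWithinAt)
    (B := fun r => C + ∫ t in a..r, h t) ?_
    (fun t ht => (hB t ht).continuousAt.continuousWithinAt)
    (fun t ht => (hB t (Set.Ico_subset_Icc_self ht)).hasDerivWithinAt) ?_
    (Set.right_mem_Icc.2 hr.1)
  · simpa using hC _ (by simp [hu, abs_of_nonneg ha0])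
  · intro t ht
    rw [norm_mul, hu, one_mul]
    exact hgh t ⟨ht.1, ht.2.trans hr.2⟩

/-! ### Hardy's inequality and majorants of the second derivative -/

/-- A weighted Hardy inequality for primitives. -/
lemma integrableOn_sq_primitive_mul {h : ℝ → ℝ} (hh : ContinuousOn h (Set.Ioo (-1) 1)) {a C : ℝ}
    (ha : a ∈ Set.Ioo (-1 : ℝ) 1)
    (hint : IntegrableOn (fun r => h r ^ 2 * (1 - r) ^ 3) (Set.Ioo a 1)) :
    IntegrableOn (fun r => (C + ∫ t in a..r, h t) ^ 2 * (1 - r)) (Set.Ioo a 1) := by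
  set N : ℝ → ℝ := fun r => C + ∫ t in a..r, h t with hNdef
  have hN : ∀ r ∈ Set.Ioo (-1 : ℝ) 1, HasDerivAt N (h r) r := fun r hr =>
    (hasDerivAt_integral_of_continuousOn hh ha hr).const_add C
  have hNc : ContinuousOn N (Set.Ioo (-1) 1) := fun r hr =>
    (hN r hr).continuousAt.continuousWithinAt
  have hsub : ∀ b < 1, Set.Icc a b ⊆ Set.Ioo (-1) 1 := fun b hb x hx =>
    ⟨ha.1.trans_le hx.1, hx.2.trans_lt hb⟩
  rw [← integrableOn_Ioc_iff_integrableOn_Ioo]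
  obtain ⟨b, -, hb, hblim⟩ := exists_seq_strictMono_tendsto' ha.2
  have hwc : ContinuousOn (fun r => N r ^ 2 * (1 - r)) (Set.Ioo (-1) 1) :=
    (hNc.pow 2).mul (by fun_prop)
  have hvc : ContinuousOn (fun r => h r ^ 2 * (1 - r) ^ 3) (Set.Ioo (-1) 1) :=
    (hh.pow 2).mul (by fun_prop)
  refine integrableOn_Ioc_of_intervalIntegral_norm_bounded_right (b := b)
    (I := (∫ r in Set.Ioo a 1, h r ^ 2 * (1 - r) ^ 3) + C ^ 2 * (1 - a) ^ 2)
    (fun n => ((hwc.mono (hsub _ (hb n).2)).integrableOn_Icc).mono_set Set.Ioc_subset_Icc_self)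
    hblim (Eventually.of_forall fun n => ?_)
  have hab : a ≤ b n := (hb n).1.le
  have hsubn := hsub _ (hb n).2
  -- Integration by parts for `∫ 2(1-r)N²`, in the form of the derivative of `-(1-r)²N²`.
  have hD : ∀ r ∈ Set.uIcc a (b n), HasDerivAt (fun r => -((1 - r) ^ 2 * N r ^ 2))
      (2 * (1 - r) * N r ^ 2 - 2 * (1 - r) ^ 2 * N r * h r) r := by
    intro r hr
    rw [Set.uIcc_of_le hab] at hr
    have h1 : HasDerivAt (fun r : ℝ => (1 - r) ^ 2) (2 * (1 - r) * (-1)) r := by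
      simpa using ((hasDerivAt_id r).const_sub 1).fun_pow 2
    have h2 : HasDerivAt (fun r : ℝ => N r ^ 2) (2 * N r * h r) r := by
      simpa using (hN r (hsubn hr)).fun_pow 2
    refine (h1.fun_mul h2).fun_neg.congr_deriv ?_
    ring
  have hDc : ContinuousOn (fun r => 2 * (1 - r) * N r ^ 2 - 2 * (1 - r) ^ 2 * N r * h r)
      (Set.uIcc a (b n)) := by
    rw [Set.uIcc_of_le hab]
    have h1 := hNc.mono hsubn
    have h2 := hh.mono hsubn
    fun_prop
  have hvi : IntervalIntegrable (fun r => h r ^ 2 * (1 - r) ^ 3) volume a (b n) :=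
    (hvc.mono (by rwa [Set.uIcc_of_le hab])).intervalIntegrable
  have hwi : IntervalIntegrable (fun r => N r ^ 2 * (1 - r)) volume a (b n) :=
    (hwc.mono (by rwa [Set.uIcc_of_le hab])).intervalIntegrable
  have hnorm : ∀ r ∈ Set.Ioc a (b n), ‖N r ^ 2 * (1 - r)‖ = N r ^ 2 * (1 - r) := fun r hr =>
    Real.norm_of_nonneg (mul_nonneg (sq_nonneg _) (by linarith [hr.2, (hb n).2]))
  rw [setIntegral_congr_fun measurableSet_Ioc hnorm, ← intervalIntegral.integral_of_le hab]
  calc ∫ r in a..b n, N r ^ 2 * (1 - r)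
      ≤ ∫ r in a..b n, (h r ^ 2 * (1 - r) ^ 3 +
          (2 * (1 - r) * N r ^ 2 - 2 * (1 - r) ^ 2 * N r * h r)) := by
        refine intervalIntegral.integral_mono_on hab hwi (hvi.add hDc.intervalIntegrable) ?_
        intro r hr
        have h1 : 0 ≤ 1 - r := by linarith [hr.2, (hb n).2]
        -- The difference of the two integrands is exactly `(1-r)(N - (1-r)h)²`.
        nlinarith [mul_nonneg h1 (sq_nonneg (N r - (1 - r) * h r))]
    _ = (∫ r in a..b n, h r ^ 2 * (1 - r) ^ 3) +
          (-((1 - b n) ^ 2 * N (b n) ^ 2) - -((1 - a) ^ 2 * N a ^ 2)) := by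
        rw [intervalIntegral.integral_add hvi hDc.intervalIntegrable,
          intervalIntegral.integral_eq_sub_of_hasDerivAt hD hDc.intervalIntegrable]
    _ ≤ _ := by
        have hNa : N a = C := by simp [hNdef]
        rw [hNa, intervalIntegral.integral_of_le hab]
        have h1 : ∫ r in Set.Ioc a (b n), h r ^ 2 * (1 - r) ^ 3 ≤
            ∫ r in Set.Ioo a 1, h r ^ 2 * (1 - r) ^ 3 := by
          refine setIntegral_mono_set hint ?_
            (Set.Ioc_subset_Ioo_right (hb n).2).eventuallyLE
          refine (ae_restrict_iff' measurableSet_Ioo).2 (Eventually.of_forall fun r hr => ?_)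
          exact mul_nonneg (sq_nonneg _) (pow_nonneg (by linarith [hr.2]) 3)
        -- The boundary term at `b n` is nonpositive and is dropped; the one at `a` gives
        -- `C²(1-a)²`, so the bound is uniform in `n`.
        nlinarith [mul_nonneg (sq_nonneg (1 - b n)) (sq_nonneg (N (b n)))]

/-- A radial majorant `h` of `f''` with `∫ h(r)² (1 - r)³ dr < ∞` forces `f ∈ VMOA`. -/
lemma isVMOA_of_norm_deriv_deriv_le {f : ℂ → ℂ} (hf : DifferentiableOn ℂ f disc) {h : ℝ → ℝ}
    (hh : ContinuousOn h (Set.Ioo (-1) 1)) {a : ℝ} (ha0 : 0 ≤ a) (ha1 : a < 1)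
    (hfh : ∀ u : ℂ, ‖u‖ = 1 → ∀ t ∈ Set.Ico a 1, ‖deriv (deriv f) (t * u)‖ ≤ h t)
    (hint : IntegrableOn (fun r => h r ^ 2 * (1 - r) ^ 3) (Set.Ioo a 1)) :
    IsVMOA f := by
  classical
  have ha : a ∈ Set.Ioo (-1 : ℝ) 1 := ⟨by linarith, ha1⟩
  have hf' : DifferentiableOn ℂ (deriv f) disc := hf.deriv isOpen_disc
  obtain ⟨C, hC⟩ := exists_norm_le_of_norm_le hf' ha1
  -- The `max` freezes the majorant at the constant `C` on `|z| ≤ a`, where `h` gives no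
  -- information.
  set P : ℝ → ℝ := fun r => C + ∫ t in a..max a r, h t with hP
  have hPc : ContinuousOn P (Set.Iio 1) := by
    have h1 : ContinuousOn (fun r => ∫ t in a..r, h t) (Set.Ioo (-1) 1) := fun r hr =>
      (hasDerivAt_integral_of_continuousOn hh ha hr).continuousAt.continuousWithinAt
    exact continuousOn_const.add (h1.comp (f := fun r => max a r) (by fun_prop) fun r hr =>
      ⟨ha.1.trans_le (le_max_left _ _), max_lt ha1 hr⟩)
  set N : ℝ → ℝ := (Set.Iio 1).indicator P with hNdef
  have hN : Measurable N := hPc.measurable_piecewise continuousOn_const measurableSet_Iio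
  have hN1 : ∀ r ∈ Set.Ioc 0 a, N r = C := by
    intro r hr
    simp [hNdef, hP, hr.2.trans_lt ha1, max_eq_left hr.2]
  have hN2 : ∀ r ∈ Set.Ico a 1, N r = C + ∫ t in a..r, h t := by
    intro r hr
    simp [hNdef, hP, hr.2, max_eq_right hr.1]
  refine isVMOA_of_norm_deriv_le hf hN (fun z hz => ?_) ?_
  · rcases le_total ‖z‖ a with hza | hza
    · have : N ‖z‖ = C := by simp [hNdef, hP, mem_disc.1 hz, max_eq_left hza]
      exact this ▸ hC z hza
    · rw [hN2 _ ⟨hza, mem_disc.1 hz⟩]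
      obtain ⟨u, hu, hzu⟩ : ∃ u : ℂ, ‖u‖ = 1 ∧ z = ‖z‖ * u :=
        ⟨Complex.exp (Complex.arg z * Complex.I), Complex.norm_exp_ofReal_mul_I _,
          (Complex.norm_mul_exp_arg_mul_I z).symm⟩
      have := norm_le_add_integral hf' hh ha0 ha1 hC hu (hfh u hu) ⟨hza, mem_disc.1 hz⟩
      rwa [← hzu] at this
  · have hsub : Set.Ioo (0 : ℝ) 1 ⊆ Set.Ioc 0 a ∪ Set.Ioo a 1 := fun r hr =>
      (le_or_gt r a).imp (fun h => ⟨hr.1, h⟩) fun h => ⟨h, hr.2⟩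
    have hi1 : IntegrableOn (fun r => N r ^ 2 * (1 - r ^ 2)) (Set.Ioc 0 a) := by
      refine IntegrableOn.congr_fun (f := fun r => C ^ 2 * (1 - r ^ 2)) ?_
        (fun r hr => by simp only [hN1 r hr]) measurableSet_Ioc
      exact (Continuous.integrableOn_Icc (by fun_prop)).mono_set Set.Ioc_subset_Icc_self
    have hi2 : IntegrableOn (fun r => N r ^ 2 * (1 - r ^ 2)) (Set.Ioo a 1) := by
      -- The factor 2 comes from `1 - r² ≤ 2(1 - r)`.
      refine ((integrableOn_sq_primitive_mul (C := C) hh ha hint).const_mul 2).mono'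
        (Measurable.aestronglyMeasurable (by fun_prop)) ?_
      refine (ae_restrict_iff' measurableSet_Ioo).2 (Eventually.of_forall fun r hr => ?_)
      have hr1 : 0 ≤ 1 - r := by linarith [hr.2]
      have hr2 : 0 ≤ r := ha0.trans hr.1.le
      rw [← hN2 r ⟨hr.1.le, hr.2⟩, Real.norm_of_nonneg (mul_nonneg (sq_nonneg _) (by nlinarith))]
      nlinarith [mul_nonneg (sq_nonneg (N r)) (mul_nonneg hr1 hr1)]
    exact ((hi1.union hi2).mono_set hsub).lintegral_lt_top.ne

end DiscODE

/-! ### The theorem -/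

theorem theorem9 (A : ℂ → ℂ) (hA : DifferentiableOn ℂ A DiscODE.disc)
    (h : ∃ r₀ : ℝ, 0 ≤ r₀ ∧ r₀ < 1 ∧
      IntegrableOn
        (fun r : ℝ => DiscODE.maxModulus r A ^ 2 *
          Real.exp (2 * ∫ t in r₀..r, DiscODE.maxModulus t A * (1 - t)) * (1 - r ^ 2) ^ 3)
        (Set.Ioo r₀ 1) volume) :
    ∀ f : ℂ → ℂ, DiscODE.IsSolution A f → DiscODE.IsVMOA f := by
  intro f hf
  obtain ⟨a, ha0, ha1, hint⟩ := h
  have ha : a ∈ Set.Ioo (-1 : ℝ) 1 := ⟨by linarith, ha1⟩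
  obtain ⟨C, hC⟩ := DiscODE.exists_norm_solution_le hA hf ha0 ha1
  have hM := DiscODE.continuousOn_maxModulus_abs hA.continuousOn
  have hk : ContinuousOn (fun t : ℝ => DiscODE.maxModulus |t| A * (1 - t)) (Set.Ioo (-1) 1) :=
    hM.mul (by fun_prop)
  have hE : ContinuousOn
      (fun r => Real.exp (∫ t in a..r, DiscODE.maxModulus |t| A * (1 - t))) (Set.Ioo (-1) 1) :=
    fun r hr => (DiscODE.hasDerivAt_integral_of_continuousOn hk ha
      hr).exp.continuousAt.continuousWithinAt
  have hh : ContinuousOn (fun r => DiscODE.maxModulus |r| A *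
      (C * Real.exp (∫ t in a..r, DiscODE.maxModulus |t| A * (1 - t)))) (Set.Ioo (-1) 1) :=
    hM.mul (continuousOn_const.mul hE)
  refine DiscODE.isVMOA_of_norm_deriv_deriv_le hf.1 hh ha0 ha1 (fun u hu t ht => ?_) ?_
  · have hz := DiscODE.ofReal_mul_mem_disc hu (t := t) ⟨ha.1.trans_le ht.1, ht.2⟩
    have hAz := DiscODE.norm_le_maxModulus hA.continuousOn hz
    rw [norm_mul, hu, mul_one, Complex.norm_real, Real.norm_eq_abs] at hAz
    rw [eq_neg_of_add_eq_zero_left (hf.2 _ hz), norm_neg, norm_mul]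
    exact mul_le_mul hAz (hC u hu t ht) (norm_nonneg _) (DiscODE.maxModulus_nonneg _ _)
  · refine (hint.const_mul (C ^ 2)).mono' ?_ ?_
    · refine ContinuousOn.aestronglyMeasurable ?_ measurableSet_Ioo
      exact ((hh.pow 2).mul (by fun_prop)).mono (Set.Ioo_subset_Ioo_left ha.1.le)
    · refine (ae_restrict_iff' measurableSet_Ioo).2 (Eventually.of_forall fun r hr => ?_)
      have hr0 : 0 ≤ r := ha0.trans hr.1.le
      have hr1 : 0 ≤ 1 - r := by linarith [hr.2]
      have hI : ∫ t in a..r, DiscODE.maxModulus t A * (1 - t) =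
          ∫ t in a..r, DiscODE.maxModulus |t| A * (1 - t) := by
        refine intervalIntegral.integral_congr fun t ht => ?_
        rw [Set.uIcc_of_le hr.1.le] at ht
        simp only [abs_of_nonneg (ha0.trans ht.1)]
      -- This matches the weight `(1-r)³` of the Hardy step with that of the hypothesis; squaring
      -- the growth bound accounts for the 2 in the exponential.
      have hle : (1 - r) ^ 3 ≤ (1 - r ^ 2) ^ 3 := pow_le_pow_left₀ hr1 (by nlinarith) 3
      rw [hI, abs_of_nonneg hr0, two_mul, Real.exp_add,
        Real.norm_of_nonneg (mul_nonneg (sq_nonneg _) (pow_nonneg hr1 3))]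
      set E := Real.exp (∫ t in a..r, DiscODE.maxModulus |t| A * (1 - t))
      calc (DiscODE.maxModulus r A * (C * E)) ^ 2 * (1 - r) ^ 3
          ≤ (DiscODE.maxModulus r A * (C * E)) ^ 2 * (1 - r ^ 2) ^ 3 := by gcongr
        _ = _ := by ring
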